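/- Let $U$ be a finite-dimensional vector superspace over $\mathbb{C}$ with a homogeneous basis $A=A_{\bar 0}\cup A_{\bar 1}$ and let $(t_a)_{a\in A}$ be complex numbers. Let $F^{ch}_{N=1}$ be the supersymmetric charged free fermion vertex algebra of $U$, that is, the universal enveloping $N_K=1$ SUSY vertex algebra generated by vectors $\phi_a$ (of the parity of $a$) and $\phi^{\bar a}$ (of the opposite parity), $a\in A$, with $\Lambda$-brackets $[\phi_a\,{}_\Lambda\,\phi^{\bar b}]=\delta_{ab}|0\rangle$ and $[\phi_a\,{}_\Lambda\,\phi_b]=[\phi^{\bar a}\,{}_\Lambda\,\phi^{\bar b}]=0$. Write $D$ for its odd derivation, $\partial=D^2$, $Y(v,z,\theta)=\sum_{j\in\mathbb Z} z^{-j-1}v_{(j|1)}+\theta\sum_{j\in\mathbb Z} z^{-j-1}v_{(j|0)}$ for the superfield of a vector $v$, and $ab=a_{(-1|1)}b$ for the normally ordered product. Put $$T^{ch}_{sh}=\sum_{a\in A_{\bar 0}}\big((t_a+1)\,\partial\phi_a\phi^{\bar a}+t_a\,\phi_a\partial\phi^{\bar a}+D\phi_aD\phi^{\bar a}\big)+\sum_{a\in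 A_{\bar 1}}\big(t_a\,\partial\phi_a\phi^{\bar a}+(t_a+1)\,\phi_a\partial\phi^{\bar a}+D\phi_aD\phi^{\bar a}\big),$$ $$J^{ch}_{sh}=\sum_{a\in A_{\bar 0}}\big(D\phi_a\phi^{\bar a}+t_a(D\phi_a\phi^{\bar a}+\phi_aD\phi^{\bar a})\big)+\sum_{a\in A_{\bar 1}}\big(D\phi^{\bar a}\phi_a+t_a(D\phi^{\bar a}\phi_a+\phi^{\bar a}D\phi_a)\big),$$ $$Q=\tfrac12\big((T^{ch}_{sh})_{(0|1)}-(J^{ch}_{sh})_{(0|0)}\big).$$ For $m\in\mathbb C$, a vector $v\in F^{ch}_{N=1}$ is said to have charge $m$ if $(J^{ch}_{sh})_{(0|1)}v=m\,v$ (the zero vector being allowed). If $v\in F^{ch}_{N=1}$ has charge $m$, then $Q(v)$ has charge $m+1$. -/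

import Mathlib

namespace SUSYFermion

/-! ### The generating superfields and their modes

`A` is a homogeneous basis of the finite-dimensional vector superspace `U` over `ℂ` and
`par a` is the parity of the basis vector `a`. -/

/-- The sign `(-1)^i` of a parity `i`. -/
noncomputable def sgn (i : ZMod 2) : ℂ := if i = 0 then 1 else -1

/-- The basis of `φ_U ⊕ φ^Ū`: the vectors `φ_a` and `φ^ā`, for `a ∈ A`. -/
inductive Gen (A : Type*) : Type _
  | phi (a : A) : Gen A
  | phiBar (a : A) : Gen A

/-- The vector paired with a given one: `φ_a ↔ φ^ā`. -/
def Gen.dual {A : Type*} : Gen A → Gen A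
  | .phi a => .phiBar a
  | .phiBar a => .phi a

/-- Since `φ_U ≃ U` and `φ^Ū ≃ Π U*`, the parity of `φ_a` is that of `a`, and the parity of `φ^ā`
is the opposite one. -/
def Gen.parity {A : Type*} (par : A → ZMod 2) : Gen A → ZMod 2
  | .phi a => par a
  | .phiBar a => par a + 1

/-- The two components of a generating superfield
`x(z, θ) = ∑ₙ z^(-n-1) x_(n|1) + θ ∑ₙ z^(-n-1) x_(n|0)`, indexed by `(x, 1)` and `(x, 0)`.
As `x_(n|0) = (Dx)_(n|1)`, the second component is the field of the vector `D x`. -/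
abbrev Comp (A : Type*) : Type _ := Gen A × ZMod 2

/-- The parity of the operators `x_(n|i)`. -/
def Comp.parity {A : Type*} (par : A → ZMod 2) (X : Comp A) : ZMod 2 :=
  X.1.parity par + X.2 + 1

open Classical in
/-- The scalars `x_(0|i) (D^(k+1) y)`, for the components `(x, i)` and `(y, k)`, determined by the
`Λ`-brackets `[φ_a Λ φ^b̄] = δ_ab = [φ^b̄ Λ φ_a]` and `[φ_a Λ φ_b] = 0 = [φ^ā Λ φ^b̄]` through
sesquilinearity: `x_(0|0) x̄ = 1`, `x_(0|1) (D x̄) = -(-1)^x`, and zero otherwise. -/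
noncomputable def pairing {A : Type*} (par : A → ZMod 2) (X Y : Comp A) : ℂ :=
  if Y.1 = X.1.dual ∧ Y.2 = X.2 + 1 then
    (if X.2 = 0 then 1 else - sgn (X.1.parity par))
  else 0

/-- The (super)commutation relations
`[x_(m|i), y_(n|k)] = (x_(0|i) D^(k+1) y) δ_{m+n,-1}` between the modes of the generating
superfields. -/
inductive ModeRel {A : Type*} (par : A → ZMod 2) :
    FreeAlgebra ℂ (Comp A × ℤ) → FreeAlgebra ℂ (Comp A × ℤ) → Prop
  | comm (X Y : Comp A) (m n : ℤ) :
      ModeRel par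
        (FreeAlgebra.ι ℂ (X, m) * FreeAlgebra.ι ℂ (Y, n))
        (sgn (X.parity par * Y.parity par) • (FreeAlgebra.ι ℂ (Y, n) * FreeAlgebra.ι ℂ (X, m))
          + algebraMap ℂ _ (if m + n = -1 then pairing par X Y else 0))

/-- The associative algebra generated by the modes of the generating superfields. -/
abbrev ModeAlgebra {A : Type*} (par : A → ZMod 2) : Type _ := RingQuot (ModeRel par)

/-- The mode `x_(n|i)` in the mode algebra. -/
noncomputable def genMode {A : Type*} (par : A → ZMod 2) (X : Comp A) (n : ℤ) : ModeAlgebra par :=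
  RingQuot.mkAlgHom ℂ (ModeRel par) (FreeAlgebra.ι ℂ (X, n))

/-- The left ideal generated by the annihilation modes `x_(n|i)`, `n ≥ 0`. -/
noncomputable def annihilators {A : Type*} (par : A → ZMod 2) :
    Submodule (ModeAlgebra par) (ModeAlgebra par) :=
  Submodule.span (ModeAlgebra par) {w | ∃ (X : Comp A) (n : ℤ), 0 ≤ n ∧ w = genMode par X n}

/-- The superspace of `F^ch_{N=1}`: the universal enveloping supersymmetric vertex algebra of
`R^ch_{N=1}`, realized as the vacuum module over the mode algebra, that is, the module generated by
a vector `|0⟩` with the only relations `x_(n|i) |0⟩ = 0` for `n ≥ 0`. -/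
def Fch {A : Type*} (par : A → ZMod 2) : Type _ := ModeAlgebra par ⧸ annihilators par

variable {A : Type*} (par : A → ZMod 2)

noncomputable instance : AddCommGroup (Fch par) :=
  inferInstanceAs (AddCommGroup (ModeAlgebra par ⧸ annihilators par))

noncomputable instance : Module (ModeAlgebra par) (Fch par) :=
  inferInstanceAs (Module (ModeAlgebra par) (ModeAlgebra par ⧸ annihilators par))

noncomputable instance : Module ℂ (Fch par) :=
  inferInstanceAs (Module ℂ (ModeAlgebra par ⧸ annihilators par))

instance : IsScalarTower ℂ (ModeAlgebra par) (Fch par) :=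
  inferInstanceAs (IsScalarTower ℂ (ModeAlgebra par) (ModeAlgebra par ⧸ annihilators par))

/-- The vacuum vector `|0⟩`. -/
noncomputable def vac : Fch par :=
  Submodule.Quotient.mk (p := annihilators par) (1 : ModeAlgebra par)

/-- The operator `x_(n|i)` on `F^ch_{N=1}`. -/
noncomputable def gop (X : Comp A) (n : ℤ) : Module.End ℂ (Fch par) :=
  Module.toModuleEnd ℂ (S := ModeAlgebra par) (Fch par) (genMode par X n)

theorem gop_comm (X Y : Comp A) (m n : ℤ) (v : Fch par) :
    gop par X m (gop par Y n v) =
      sgn (X.parity par * Y.parity par) • gop par Y n (gop par X m v)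
        + (if m + n = -1 then pairing par X Y else 0) • v := by
  have h := RingQuot.mkAlgHom_rel ℂ (ModeRel.comm (par := par) X Y m n)
  simp only [map_mul, map_add, map_smul, AlgHom.commutes] at h
  have h2 := congrArg (fun w => w • v) h
  simp only [add_smul, mul_smul, smul_assoc, algebraMap_smul] at h2
  exact h2

theorem gop_vac (X : Comp A) (n : ℤ) (hn : 0 ≤ n) : gop par X n (vac par) = 0 := by
  change (Submodule.Quotient.mk (p := annihilators par) (genMode par X n • (1 : ModeAlgebra par))
    : ModeAlgebra par ⧸ annihilators par) = 0
  rw [Submodule.Quotient.mk_eq_zero, smul_eq_mul, mul_one]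
  exact Submodule.subset_span ⟨X, n, hn, rfl⟩

/-- `F^ch_{N=1}` is spanned by the vectors obtained from the vacuum by applying modes. -/
theorem Fch.induction {P : Fch par → Prop} (hvac : P (vac par))
    (hadd : ∀ v w, P v → P w → P (v + w)) (hsmul : ∀ (c : ℂ) v, P v → P (c • v))
    (hgop : ∀ X n v, P v → P (gop par X n v)) (v : Fch par) : P v := by
  obtain ⟨w, rfl⟩ := Submodule.Quotient.mk_surjective (annihilators par) v
  obtain ⟨f, rfl⟩ := RingQuot.mkAlgHom_surjective ℂ (ModeRel par) w
  have key : ∀ f : FreeAlgebra ℂ (Comp A × ℤ), ∀ v : Fch par, P v →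
      P (RingQuot.mkAlgHom ℂ (ModeRel par) f • v) := by
    intro f
    induction f using FreeAlgebra.induction with
    | grade0 r => intro v hv; simpa only [AlgHom.commutes, algebraMap_smul] using hsmul r v hv
    | grade1 x => intro v hv; exact hgop x.1 x.2 v hv
    | mul a b ha hb => intro v hv; rw [map_mul, mul_smul]; exact ha _ (hb _ hv)
    | add a b ha hb => intro v hv; rw [map_add, add_smul]; exact hadd _ _ (ha _ hv) (hb _ hv)
  have h := key f _ hvac
  have e : RingQuot.mkAlgHom ℂ (ModeRel par) f • vac par =
      (Submodule.Quotient.mk (RingQuot.mkAlgHom ℂ (ModeRel par) f) :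
        ModeAlgebra par ⧸ annihilators par) := by
    change (Submodule.Quotient.mk (p := annihilators par)
      (RingQuot.mkAlgHom ℂ (ModeRel par) f • (1 : ModeAlgebra par)) : _) = _
    rw [smul_eq_mul, mul_one]
  rw [e] at h
  exact h

/-- Operators on a vector space `H` that satisfy the commutation relations of the modes of the
generating superfields, and a vector that is killed by the annihilation modes. -/
structure ModeAction (H : Type*) [AddCommGroup H] [Module ℂ H] where
  op : Comp A → ℤ → Module.End ℂ H
  comm : ∀ X Y m n h, op X m (op Y n h) = sgn (X.parity par * Y.parity par) • op Y n (op X m h)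
    + (if m + n = -1 then pairing par X Y else 0) • h
  base : H
  ann : ∀ X n, 0 ≤ n → op X n base = 0

section Lift

variable {H : Type*} [AddCommGroup H] [Module ℂ H] (S : ModeAction par H)

/-- The action of the mode algebra. -/
noncomputable def liftAlg : ModeAlgebra par →ₐ[ℂ] Module.End ℂ H :=
  RingQuot.liftAlgHom ℂ ⟨FreeAlgebra.lift ℂ (fun x => S.op x.1 x.2), by
    rintro _ _ ⟨X, Y, m, n⟩
    ext h
    simp only [map_mul, map_add, map_smul, AlgHom.commutes, FreeAlgebra.lift_ι_apply]
    simp only [Module.End.mul_apply, LinearMap.add_apply, LinearMap.smul_apply,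
      Algebra.algebraMap_eq_smul_one, Module.End.one_apply]
    exact S.comm X Y m n h⟩

theorem liftAlg_genMode (X : Comp A) (n : ℤ) : liftAlg par S (genMode par X n) = S.op X n := by
  simp [liftAlg, genMode]

/-- The universal property of the vacuum module: the linear map that sends the vacuum to the given
vector and commutes with the modes. -/
noncomputable def lift : Fch par →ₗ[ℂ] H :=
  Submodule.liftQ ((annihilators par).restrictScalars ℂ)
    ((LinearMap.applyₗ S.base).comp (liftAlg par S).toLinearMap) (by
      intro w hw
      change liftAlg par S w S.base = 0
      refine Submodule.span_induction (p := fun w _ => liftAlg par S w S.base = 0) ?_ ?_ ?_ ?_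
        ((Submodule.restrictScalars_mem ℂ _ _).1 hw)
      · rintro _ ⟨X, n, hn, rfl⟩
        rw [liftAlg_genMode]; exact S.ann X n hn
      · simp
      · intro x y _ _ hx hy; simp [hx, hy]
      · intro a x _ hx; simp [hx])

theorem lift_vac : lift par S (vac par) = S.base := by
  change liftAlg par S 1 S.base = S.base
  simp

theorem lift_gop (X : Comp A) (n : ℤ) (v : Fch par) :
    lift par S (gop par X n v) = S.op X n (lift par S v) := by
  obtain ⟨w, rfl⟩ := Submodule.Quotient.mk_surjective (annihilators par) v
  change liftAlg par S (genMode par X n * w) S.base = S.op X n (liftAlg par S w S.base)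
  rw [map_mul, liftAlg_genMode]; rfl

end Lift

theorem sgn_mul_self (i : ZMod 2) : sgn i * sgn i = 1 := by
  unfold sgn; split_ifs <;> norm_num

theorem zmod_two_cases (i : ZMod 2) : i = 0 ∨ i = 1 := by
  revert i; decide

theorem sgn_zero : sgn 0 = 1 := by simp [sgn]

theorem sgn_one : sgn 1 = -1 := by simp [sgn]

theorem sgn_add (i k : ZMod 2) : sgn (i + k) = sgn i * sgn k := by
  have h : (1 : ZMod 2) + 1 = 0 := by decide
  rcases zmod_two_cases i with rfl | rfl <;> rcases zmod_two_cases k with rfl | rfl <;>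
    simp [sgn_zero, sgn_one, h]

theorem Gen.parity_dual (x : Gen A) : x.dual.parity par = x.parity par + 1 := by
  have h : (1 : ZMod 2) + 1 = 0 := by decide
  cases x <;> simp [Gen.dual, Gen.parity, add_assoc, h]

theorem pairing_parity {X Y : Comp A} (h : pairing par X Y ≠ 0) : X.parity par = Y.parity par := by
  have h2 : (1 : ZMod 2) + 1 = 0 := by decide
  unfold pairing at h
  by_cases h1 : Y.1 = X.1.dual ∧ Y.2 = X.2 + 1
  · simp only [Comp.parity, h1.1, h1.2, Gen.parity_dual]
    linear_combination -h2
  · rw [if_neg h1] at h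
    exact absurd rfl h

/-- The parity automorphism `v ↦ (-1)^v v` of the superspace `F^ch_{N=1}`. -/
noncomputable def parityOp : Module.End ℂ (Fch par) :=
  lift par
    { op := fun X n => sgn (X.parity par) • gop par X n
      base := vac par
      ann := fun X n hn => by simp [gop_vac par X n hn]
      comm := fun X Y m n h => by
        simp only [LinearMap.smul_apply, map_smul, gop_comm par X Y m n, smul_add, smul_smul]
        congr 1
        · congr 1; ring
        · by_cases hp : pairing par X Y = 0
          · simp [hp]
          · rw [pairing_parity par hp, ← mul_assoc, sgn_mul_self, one_mul] }

/-- The field of the component `D X`: one has `D (x, 1) = (x, 0)`, and `D (x, 0) = ∂ x` has the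
modes `(∂ x)_(n|1) = -n x_(n-1|1)`. -/
noncomputable def dop (X : Comp A) (n : ℤ) : Module.End ℂ (Fch par) :=
  if X.2 = 1 then gop par (X.1, 0) n else (-(n : ℂ)) • gop par (X.1, 1) (n - 1)

theorem dop_vac (X : Comp A) (n : ℤ) (hn : 0 ≤ n) : dop par X n (vac par) = 0 := by
  unfold dop
  split_ifs
  · exact gop_vac par _ _ hn
  · rcases hn.eq_or_lt with rfl | h
    · simp
    · rw [LinearMap.smul_apply, gop_vac par _ _ (by omega), smul_zero]

theorem dop_one (x : Gen A) (n : ℤ) : dop par (x, 1) n = gop par (x, 0) n := by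
  simp [dop]

theorem dop_zero (x : Gen A) (n : ℤ) :
    dop par (x, 0) n = (-(n : ℂ)) • gop par (x, 1) (n - 1) := by
  simp [dop]

theorem sgn_mul_one_add (i k : ZMod 2) : sgn (i * (k + 1)) = sgn (i * k) * sgn i := by
  rw [mul_add, sgn_add, mul_one]

theorem sgn_one_add_mul (i k : ZMod 2) : sgn ((i + 1) * k) = sgn (i * k) * sgn k := by
  rw [add_mul, sgn_add, one_mul]

theorem dop_comm (X Y : Comp A) (m n : ℤ) (v : Fch par) :
    sgn (X.parity par) • gop par X m (dop par Y n v) + dop par X m (gop par Y n v) =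
      sgn (X.parity par * Y.parity par) • (sgn (Y.parity par) • gop par Y n (dop par X m v)
        + dop par Y n (gop par X m v)) := by
  obtain ⟨x, i⟩ := X
  obtain ⟨y, k⟩ := Y
  have h2 : (1 : ZMod 2) + 1 = 0 := by decide
  have e1 : ∀ z : Gen A, Comp.parity par (z, 1) = z.parity par := by
    intro z; simp only [Comp.parity]; linear_combination h2
  have e0 : ∀ z : Gen A, Comp.parity par (z, 0) = z.parity par + 1 := by
    intro z; simp only [Comp.parity, add_zero]
  have p00 : pairing par (x, 0) (y, 0) = 0 := by simp [pairing]
  have p11 : pairing par (x, 1) (y, 1) = 0 := by simp [pairing]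
  have p10 : pairing par (x, 1) (y, 0) = - sgn (x.parity par) * pairing par (x, 0) (y, 1) := by
    by_cases hd : y = x.dual <;> simp [pairing, hd, h2]
  have hx := sgn_mul_self (x.parity par)
  have hy := sgn_mul_self (y.parity par)
  rcases zmod_two_cases i with rfl | rfl <;> rcases zmod_two_cases k with rfl | rfl
  · have h1 := gop_comm par (x, 0) (y, 1) m (n - 1) v
    have h3 := gop_comm par (x, 1) (y, 0) (m - 1) n v
    have c1 : (m + (n - 1) = -1) ↔ m + n = 0 := by omega
    have c3 : (m - 1 + n = -1) ↔ m + n = 0 := by omega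
    simp only [e0, e1, p10, c1, c3, sgn_mul_one_add, sgn_one_add_mul, dop_zero, sgn_add, sgn_one,
      LinearMap.smul_apply, map_smul] at h1 h3 ⊢
    generalize sgn (x.parity par * y.parity par) = s at *
    generalize sgn (x.parity par) = a at *
    generalize sgn (y.parity par) = b at *
    generalize pairing par (x, 0) (y, 1) = p at *
    by_cases hmn : m + n = 0
    · have hc : (n : ℂ) = - m := by
        have : ((m + n : ℤ) : ℂ) = 0 := by rw [hmn]; simp
        push_cast at this
        linear_combination this
      simp only [hmn, if_true] at h1 h3
      rw [h1, h3, hc]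
      rcases mul_self_eq_one_iff.1 hx with rfl | rfl <;>
        rcases mul_self_eq_one_iff.1 hy with rfl | rfl <;> match_scalars <;> ring
    · simp only [hmn, if_false] at h1 h3
      rw [h1, h3]
      rcases mul_self_eq_one_iff.1 hx with rfl | rfl <;>
        rcases mul_self_eq_one_iff.1 hy with rfl | rfl <;> match_scalars <;> ring
  · have h1 := gop_comm par (x, 0) (y, 0) m n v
    have h3 := gop_comm par (x, 1) (y, 1) (m - 1) n v
    simp only [e0, e1, p00, p11, ite_self, zero_smul, add_zero, sgn_mul_one_add,
      sgn_one_add_mul, dop_one, dop_zero, sgn_add, sgn_one, LinearMap.smul_apply, map_smul]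
      at h1 h3 ⊢
    generalize sgn (x.parity par * y.parity par) = s at *
    generalize sgn (x.parity par) = a at *
    generalize sgn (y.parity par) = b at *
    simp only [h1, h3]
    rcases mul_self_eq_one_iff.1 hx with rfl | rfl <;>
        rcases mul_self_eq_one_iff.1 hy with rfl | rfl <;> match_scalars <;> ring
  · have h1 := gop_comm par (x, 0) (y, 0) m n v
    have h3 := gop_comm par (x, 1) (y, 1) m (n - 1) v
    simp only [e0, e1, p00, p11, ite_self, zero_smul, add_zero, sgn_mul_one_add,
      sgn_one_add_mul, dop_one, dop_zero, sgn_add, sgn_one, LinearMap.smul_apply, map_smul]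
      at h1 h3 ⊢
    generalize sgn (x.parity par * y.parity par) = s at *
    generalize sgn (x.parity par) = a at *
    generalize sgn (y.parity par) = b at *
    simp only [h1, h3]
    rcases mul_self_eq_one_iff.1 hx with rfl | rfl <;>
        rcases mul_self_eq_one_iff.1 hy with rfl | rfl <;> match_scalars <;> ring
  · have h1 := gop_comm par (x, 1) (y, 0) m n v
    have h3 := gop_comm par (x, 0) (y, 1) m n v
    simp only [e0, e1, p10, sgn_mul_one_add, sgn_one_add_mul, dop_one]
      at h1 h3 ⊢
    generalize sgn (x.parity par * y.parity par) = s at *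
    generalize sgn (x.parity par) = a at *
    generalize sgn (y.parity par) = b at *
    simp only [h1, h3]
    split_ifs
    all_goals
      rcases mul_self_eq_one_iff.1 hx with rfl | rfl <;>
        rcases mul_self_eq_one_iff.1 hy with rfl | rfl <;> match_scalars <;> ring

/-- The odd endomorphism `D` of `F^ch_{N=1}`, the first component of the following map: it is
determined by `D |0⟩ = 0` and `[D, x_(n|i)] = (D x)_(n|i)` (supercommutator). -/
noncomputable def DPair : Fch par →ₗ[ℂ] Fch par × Fch par :=
  lift par
    { op := fun X n =>
        ((sgn (X.parity par) • (gop par X n).comp (LinearMap.fst ℂ _ _))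
          + (dop par X n).comp (LinearMap.snd ℂ _ _)).prod
        ((gop par X n).comp (LinearMap.snd ℂ _ _))
      base := (0, vac par)
      ann := fun X n hn => by simp [gop_vac par X n hn, dop_vac par X n hn]
      comm := fun X Y m n h => by
        have h1 := gop_comm par X Y m n h.1
        have h2 := gop_comm par X Y m n h.2
        have h3 := dop_comm par X Y m n h.2
        have h4 : (sgn (X.parity par) * sgn (Y.parity par)) *
            (if m + n = -1 then pairing par X Y else 0)
            = if m + n = -1 then pairing par X Y else 0 := by
          by_cases hp : pairing par X Y = 0
          · simp [hp]
          · rw [pairing_parity par hp, sgn_mul_self, one_mul]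
        refine Prod.ext ?_ h2
        change sgn (X.parity par) • gop par X m (sgn (Y.parity par) • gop par Y n h.1
            + dop par Y n h.2) + dop par X m (gop par Y n h.2)
          = sgn (X.parity par * Y.parity par) • (sgn (Y.parity par) • gop par Y n
            (sgn (X.parity par) • gop par X m h.1 + dop par X m h.2) + dop par Y n (gop par X m h.2))
            + (if m + n = -1 then pairing par X Y else 0) • h.1
        simp only [map_add, map_smul, smul_add]
        rw [smul_add] at h3
        generalize (if m + n = -1 then pairing par X Y else 0) = c at *
        have h5 := congrArg (fun w => (sgn (X.parity par) * sgn (Y.parity par)) • w) h1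
        simp only [smul_add, smul_smul, h4] at h5
        simp only [smul_smul] at h3 ⊢
        linear_combination (norm := module) h5 + h3 }

/-- The odd endomorphism `D` of `F^ch_{N=1}`. -/
noncomputable def D : Module.End ℂ (Fch par) :=
  (LinearMap.fst ℂ _ _).comp (DPair par)

theorem DPair_snd (v : Fch par) : (DPair par v).2 = v := by
  induction v using Fch.induction with
  | hvac => simp [DPair, lift_vac]
  | hadd v w hv hw => simp [hv, hw]
  | hsmul c v hv => simp [hv]
  | hgop X n v hv =>
    rw [DPair, lift_gop] at *
    exact congrArg (gop par X n) hv

theorem D_vac : D par (vac par) = 0 := by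
  change (DPair par (vac par)).1 = 0
  rw [DPair, lift_vac]

theorem D_gop (X : Comp A) (n : ℤ) (v : Fch par) :
    D par (gop par X n v) = sgn (X.parity par) • gop par X n (D par v) + dop par X n v := by
  have h := DPair_snd par v
  change (DPair par (gop par X n v)).1
    = sgn (X.parity par) • gop par X n (DPair par v).1 + dop par X n v
  rw [DPair, lift_gop, ← DPair]
  change sgn (X.parity par) • gop par X n (DPair par v).1 + dop par X n (DPair par v).2 = _
  rw [h]

/-- The even endomorphism `∂ = D²`. -/
noncomputable def del : Module.End ℂ (Fch par) := D par * D par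

theorem del_vac : del par (vac par) = 0 := by
  simp [del, D_vac]

theorem del_gop (X : Comp A) (n : ℤ) (v : Fch par) :
    del par (gop par X n v) = gop par X n (del par v) - (n : ℂ) • gop par X (n - 1) v := by
  obtain ⟨x, i⟩ := X
  have h2 : (1 : ZMod 2) + 1 = 0 := by decide
  have e1 : Comp.parity par (x, 1) = x.parity par := by
    simp only [Comp.parity]; linear_combination h2
  have e0 : Comp.parity par (x, 0) = x.parity par + 1 := by
    simp only [Comp.parity, add_zero]
  have hx := sgn_mul_self (x.parity par)
  simp only [del, Module.End.mul_apply]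
  rcases zmod_two_cases i with rfl | rfl <;>
    simp only [D_gop, map_add, map_smul, dop_one, dop_zero, LinearMap.smul_apply, e0, e1, sgn_add,
      sgn_one] <;>
    rcases mul_self_eq_one_iff.1 hx with h | h <;> rw [h] <;> module

/-- Every vector is killed by all modes of large index. -/
theorem gop_trunc (v : Fch par) : ∃ N : ℕ, ∀ X (n : ℤ), (N : ℤ) ≤ n → gop par X n v = 0 := by
  induction v using Fch.induction with
  | hvac => exact ⟨0, fun X n hn => gop_vac par X n (by simpa using hn)⟩
  | hadd v w hv hw =>
    obtain ⟨N, hN⟩ := hv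
    obtain ⟨M, hM⟩ := hw
    exact ⟨max N M, fun X n hn => by
      rw [map_add, hN X n (by omega), hM X n (by omega), add_zero]⟩
  | hsmul c v hv =>
    obtain ⟨N, hN⟩ := hv
    exact ⟨N, fun X n hn => by rw [map_smul, hN X n hn, smul_zero]⟩
  | hgop Y k v hv =>
    obtain ⟨N, hN⟩ := hv
    exact ⟨max N k.natAbs, fun X n hn => by
      rw [gop_comm, hN X n (by omega), map_zero, smul_zero, zero_add, if_neg (by omega), zero_smul]⟩

theorem parityOp_vac : parityOp par (vac par) = vac par := lift_vac par _

theorem parityOp_gop (X : Comp A) (n : ℤ) (v : Fch par) :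
    parityOp par (gop par X n v) = sgn (X.parity par) • gop par X n (parityOp par v) :=
  lift_gop par _ X n v

theorem parityOp_parityOp (v : Fch par) : parityOp par (parityOp par v) = v := by
  induction v using Fch.induction with
  | hvac => simp [parityOp_vac]
  | hadd v w hv hw => simp [hv, hw]
  | hsmul c v hv => simp [hv]
  | hgop X n v hv => simp [parityOp_gop, hv, smul_smul, sgn_mul_self]

/-- The operator `v ↦ (-1)^(p v) v`. -/
noncomputable def twist (p : ZMod 2) : Module.End ℂ (Fch par) :=
  if p = 0 then 1 else parityOp par

theorem twist_gop (p : ZMod 2) (X : Comp A) (n : ℤ) (v : Fch par) :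
    twist par p (gop par X n v) = sgn (p * X.parity par) • gop par X n (twist par p v) := by
  rcases zmod_two_cases p with rfl | rfl
  · simp [twist, sgn_zero]
  · simp [twist, parityOp_gop]

theorem twist_comm (p q : ZMod 2) (v : Fch par) :
    twist par p (twist par q v) = twist par q (twist par p v) := by
  rcases zmod_two_cases p with rfl | rfl <;> rcases zmod_two_cases q with rfl | rfl <;>
    simp [twist]

theorem twist_self (p : ZMod 2) (v : Fch par) : twist par p (twist par p v) = v := by
  rcases zmod_two_cases p with rfl | rfl <;> simp [twist, parityOp_parityOp]

/-! ### The state-field correspondence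

The fields `Y(v, z) = ∑ₙ z^(-n-1) v_(n)` (that is, `v_(n) = v_(n|1)`) are determined by
`Y(v, z)|0⟩ = e^(z∂) v` and by the commutator formula
`[X_(m), v_(n)] = ∑_{j ≥ 0} binom(m, j) (X_(j) v)_(m+n-j)` with the components `X` of the generating
superfields, since `F^ch_{N=1}` is generated from the vacuum by the modes `X_(m)`. The commutator
formula is solved for `v_(n) X_(m) w`, and `w ↦ (v_(n) w)` is obtained from the universal property
of the vacuum module. -/

/-- The sum `∑_{j ≥ 0} binom(m, j) F(X_(j) v)_(m+n-j)`; it is finite by truncation. -/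
noncomputable def commSum (X : Comp A) (m : ℤ) (F : Fch par →ₗ[ℂ] (ℤ → Fch par)) (v : Fch par)
    (n : ℤ) : Fch par :=
  ∑ᶠ j : ℕ, ((Ring.choose m j : ℤ) : ℂ) • F (gop par X j v) (m + n - j)

theorem commSum_eq (X : Comp A) (m : ℤ) (F : Fch par →ₗ[ℂ] (ℤ → Fch par)) (v : Fch par)
    (n : ℤ) (N : ℕ) (hN : ∀ j : ℕ, N ≤ j → gop par X j v = 0) :
    commSum par X m F v n =
      ∑ j ∈ Finset.range N, ((Ring.choose m j : ℤ) : ℂ) • F (gop par X j v) (m + n - j) := by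
  refine finsum_eq_sum_of_support_subset _ ?_
  intro j hj
  by_contra h
  exact hj (by simp [hN j (by simpa using h)])

/-- The operator `F ↦ (v ↦ X_(m) F((-1)^(X v) v)_(n) - ∑_j binom(m, j) F((-1)^(X v) X_(j) v))`. -/
noncomputable def fieldOp (X : Comp A) (m : ℤ) :
    Module.End ℂ (Fch par →ₗ[ℂ] (ℤ → Fch par)) where
  toFun F :=
    { toFun := fun v n => gop par X m (F (twist par (X.parity par) v) n)
        - commSum par X m F (twist par (X.parity par) v) n
      map_add' := fun v w => by
        obtain ⟨N, hN⟩ := gop_trunc par (twist par (X.parity par) v)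
        obtain ⟨M, hM⟩ := gop_trunc par (twist par (X.parity par) w)
        funext n
        rw [Pi.add_apply,
          commSum_eq par X m F _ n (max N M) (fun j hj => by
            rw [map_add, map_add, hN X j (by omega), hM X j (by omega), add_zero]),
          commSum_eq par X m F (twist par (X.parity par) v) n (max N M)
            (fun j hj => hN X j (by omega)),
          commSum_eq par X m F (twist par (X.parity par) w) n (max N M)
            (fun j hj => hM X j (by omega))]
        simp only [map_add, Pi.add_apply, smul_add, Finset.sum_add_distrib]
        abel
      map_smul' := fun c v => by
        obtain ⟨N, hN⟩ := gop_trunc par (twist par (X.parity par) v)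
        funext n
        rw [RingHom.id_apply, Pi.smul_apply,
          commSum_eq par X m F _ n N (fun j hj => by
            rw [map_smul, map_smul, hN X j (by omega), smul_zero]),
          commSum_eq par X m F (twist par (X.parity par) v) n N
            (fun j hj => hN X j (by omega))]
        simp only [map_smul, Pi.smul_apply, smul_sub, Finset.smul_sum, smul_comm c] }
  map_add' F G := by
    ext v n
    obtain ⟨N, hN⟩ := gop_trunc par (twist par (X.parity par) v)
    have h := fun F => commSum_eq par X m F (twist par (X.parity par) v) n N
      (fun j hj => hN X j (by omega))
    simp only [LinearMap.coe_mk, AddHom.coe_mk, LinearMap.add_apply, Pi.add_apply, h, map_add,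
      smul_add, Finset.sum_add_distrib]
    abel
  map_smul' c F := by
    ext v n
    obtain ⟨N, hN⟩ := gop_trunc par (twist par (X.parity par) v)
    have h := fun F => commSum_eq par X m F (twist par (X.parity par) v) n N
      (fun j hj => hN X j (by omega))
    simp only [LinearMap.coe_mk, AddHom.coe_mk, LinearMap.smul_apply, Pi.smul_apply, h, map_smul,
      RingHom.id_apply, smul_sub, Finset.smul_sum, smul_comm c]

theorem fieldOp_apply (X : Comp A) (m : ℤ) (F : Fch par →ₗ[ℂ] (ℤ → Fch par)) (v : Fch par)
    (n : ℤ) (N : ℕ) (hN : ∀ j : ℕ, N ≤ j → gop par X j (twist par (X.parity par) v) = 0) :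
    fieldOp par X m F v n = gop par X m (F (twist par (X.parity par) v) n)
      - ∑ j ∈ Finset.range N, ((Ring.choose m j : ℤ) : ℂ) •
          F (gop par X j (twist par (X.parity par) v)) (m + n - j) := by
  rw [← commSum_eq par X m F _ n N hN]; rfl

theorem fieldOp_fieldOp (X Y : Comp A) (m k : ℤ) (F : Fch par →ₗ[ℂ] (ℤ → Fch par)) (v u : Fch par)
    (n : ℤ) (N : ℕ) (hu : twist par (Y.parity par) (twist par (X.parity par) v) = u)
    (h₁ : ∀ Z (j : ℤ), (N : ℤ) ≤ j → gop par Z j (twist par (X.parity par) v) = 0)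
    (h₂ : ∀ Z (j : ℤ), (N : ℤ) ≤ j → gop par Z j u = 0) :
    fieldOp par X m (fieldOp par Y k F) v n =
      gop par X m (gop par Y k (F u n))
      - ∑ i ∈ Finset.range N, ((Ring.choose k i : ℤ) : ℂ) • gop par X m (F (gop par Y i u) (k + n - i))
      - sgn (X.parity par * Y.parity par) • ∑ j ∈ Finset.range N, ((Ring.choose m j : ℤ) : ℂ) •
          gop par Y k (F (gop par X j u) (m + n - j))
      + sgn (X.parity par * Y.parity par) • ∑ j ∈ Finset.range N, ∑ i ∈ Finset.range N,
          (((Ring.choose m j : ℤ) : ℂ) * ((Ring.choose k i : ℤ) : ℂ)) •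
            F (gop par Y i (gop par X j u)) (m + k + n - j - i) := by
  have hs : ∀ j : ℤ, twist par (Y.parity par) (gop par X j (twist par (X.parity par) v))
      = sgn (X.parity par * Y.parity par) • gop par X j u := by
    intro j; rw [twist_gop, hu, mul_comm]
  rw [fieldOp_apply par X m _ v n N (fun j hj => h₁ X j (by omega)),
    fieldOp_apply par Y k F _ n N (fun j hj => by rw [hu]; exact h₂ Y j (by omega)), hu]
  have hin : ∀ j : ℕ, fieldOp par Y k F (gop par X j (twist par (X.parity par) v)) (m + n - j) =
      sgn (X.parity par * Y.parity par) • (gop par Y k (F (gop par X j u) (m + n - j))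
        - ∑ i ∈ Finset.range N, ((Ring.choose k i : ℤ) : ℂ) •
          F (gop par Y i (gop par X j u)) (m + k + n - j - i)) := by
    intro j
    rw [fieldOp_apply par Y k F _ _ N (fun i hi => by
      rw [hs, map_smul, gop_comm, h₂ Y i (by omega), map_zero, smul_zero, zero_add,
        if_neg (by omega), zero_smul, smul_zero]), hs]
    simp only [map_smul, Pi.smul_apply, smul_sub, Finset.smul_sum]
    congr 1
    refine Finset.sum_congr rfl fun i _ => ?_
    rw [smul_comm, show k + (m + n - (j : ℤ)) - (i : ℤ) = m + k + n - j - i by ring]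
  simp only [hin, map_sub, map_sum, map_smul, smul_sub, Finset.sum_sub_distrib, Finset.smul_sum,
    smul_smul]
  have c1 : ∀ j : ℕ, ((Ring.choose m j : ℤ) : ℂ) * sgn (X.parity par * Y.parity par)
      = sgn (X.parity par * Y.parity par) * ((Ring.choose m j : ℤ) : ℂ) := fun j => mul_comm _ _
  have c2 : ∀ j i : ℕ, ((Ring.choose m j : ℤ) : ℂ) *
      (sgn (X.parity par * Y.parity par) * ((Ring.choose k i : ℤ) : ℂ))
      = sgn (X.parity par * Y.parity par) *
        (((Ring.choose m j : ℤ) : ℂ) * ((Ring.choose k i : ℤ) : ℂ)) := fun j i => by ring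
  simp only [c1, c2]
  abel

theorem fieldOp_comm (X Y : Comp A) (m k : ℤ) (F : Fch par →ₗ[ℂ] (ℤ → Fch par)) :
    fieldOp par X m (fieldOp par Y k F) =
      sgn (X.parity par * Y.parity par) • fieldOp par Y k (fieldOp par X m F)
        + (if m + k = -1 then pairing par X Y else 0) • F := by
  ext v n
  obtain ⟨N₁, h₁⟩ := gop_trunc par (twist par (X.parity par) v)
  obtain ⟨N₂, h₂⟩ := gop_trunc par (twist par (Y.parity par) v)
  obtain ⟨N₃, h₃⟩ := gop_trunc par (twist par (Y.parity par) (twist par (X.parity par) v))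
  set u := twist par (Y.parity par) (twist par (X.parity par) v) with hu
  have hxy := fieldOp_fieldOp par X Y m k F v u n (max N₁ (max N₂ N₃)) hu.symm
    (fun Z j hj => h₁ Z j (by omega)) (fun Z j hj => h₃ Z j (by omega))
  have hyx := fieldOp_fieldOp par Y X k m F v u n (max N₁ (max N₂ N₃))
    (by rw [twist_comm, ← hu])
    (fun Z j hj => h₂ Z j (by omega)) (fun Z j hj => h₃ Z j (by omega))
  generalize max N₁ (max N₂ N₃) = N at *
  have hdouble : ∑ j ∈ Finset.range N, ∑ i ∈ Finset.range N,
          (((Ring.choose k j : ℤ) : ℂ) * ((Ring.choose m i : ℤ) : ℂ)) •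
            F (gop par X i (gop par Y j u)) (k + m + n - j - i)
      = sgn (X.parity par * Y.parity par) • ∑ j ∈ Finset.range N, ∑ i ∈ Finset.range N,
          (((Ring.choose m j : ℤ) : ℂ) * ((Ring.choose k i : ℤ) : ℂ)) •
            F (gop par Y i (gop par X j u)) (m + k + n - j - i) := by
    rw [Finset.sum_comm, Finset.smul_sum]
    refine Finset.sum_congr rfl fun j _ => ?_
    rw [Finset.smul_sum]
    refine Finset.sum_congr rfl fun i _ => ?_
    rw [gop_comm par X Y, if_neg (by omega), zero_smul, add_zero, map_smul, Pi.smul_apply,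
      smul_comm, mul_comm (((Ring.choose m j : ℤ) : ℂ)),
      show k + m + n - (i : ℤ) - (j : ℤ) = m + k + n - j - i by ring]
  have hF : (if m + k = -1 then pairing par X Y else 0) • F u n
      = (if m + k = -1 then pairing par X Y else 0) • F v n := by
    by_cases hp : pairing par X Y = 0
    · simp [hp]
    · rw [hu, pairing_parity par hp, twist_self]
  rw [mul_comm (Y.parity par), hdouble] at hyx
  simp only [LinearMap.add_apply, LinearMap.smul_apply, Pi.add_apply, Pi.smul_apply]
  rw [hxy, hyx, gop_comm par X Y m k (F u n), hF]
  have hs := sgn_mul_self (X.parity par * Y.parity par)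
  rcases mul_self_eq_one_iff.1 hs with h | h <;> rw [h] <;> module

/-- The divided power `∂^k / k!`. -/
noncomputable def divDel (k : ℕ) : Module.End ℂ (Fch par) := (k.factorial : ℂ)⁻¹ • (del par ^ k)

theorem divDel_del (k : ℕ) (v : Fch par) :
    divDel par k (del par v) = ((k : ℂ) + 1) • divDel par (k + 1) v := by
  have hk : (k : ℂ) + 1 ≠ 0 := by exact_mod_cast Nat.succ_ne_zero k
  simp only [divDel, LinearMap.smul_apply, pow_succ, Module.End.mul_apply, smul_smul]
  congr 1
  rw [Nat.factorial_succ]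
  push_cast
  have : (k.factorial : ℂ) ≠ 0 := by exact_mod_cast Nat.factorial_ne_zero k
  field_simp

theorem succ_mul_choose (m : ℤ) (i : ℕ) :
    ((Ring.choose m i : ℤ) : ℂ) * ((m : ℂ) - i)
      = ((i : ℂ) + 1) * ((Ring.choose m (i + 1) : ℤ) : ℂ) := by
  have h := Ring.choose_smul_choose m (Nat.le_succ i)
  rw [Nat.succ_eq_add_one, Nat.choose_succ_self_right, Nat.add_sub_cancel_left,
    Ring.choose_one_right, nsmul_eq_mul] at h
  have h2 := congrArg (fun z : ℤ => (z : ℂ)) h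
  push_cast at h2
  exact h2.symm

theorem gop_divDel (X : Comp A) (m : ℤ) (k : ℕ) (v : Fch par) :
    gop par X m (divDel par k v) = ∑ p ∈ Finset.HasAntidiagonal.antidiagonal k,
      ((Ring.choose m p.1 : ℤ) : ℂ) • divDel par p.2 (gop par X (m - p.1) v) := by
  induction k generalizing v with
  | zero => simp [divDel]
  | succ k ih =>
    have hk : (k : ℂ) + 1 ≠ 0 := by exact_mod_cast Nat.succ_ne_zero k
    have h1 := ih (del par v)
    rw [divDel_del, map_smul] at h1
    rw [← smul_right_injective _ hk |>.eq_iff]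
    rw [h1]
    have h2 : ∀ p : ℕ × ℕ, ((Ring.choose m p.1 : ℤ) : ℂ) •
        divDel par p.2 (gop par X (m - p.1) (del par v)) =
        ((p.2 : ℂ) + 1) • (((Ring.choose m p.1 : ℤ) : ℂ) •
            divDel par (p.2 + 1) (gop par X (m - p.1) v))
        + ((p.1 : ℂ) + 1) • (((Ring.choose m (p.1 + 1) : ℤ) : ℂ) •
            divDel par p.2 (gop par X (m - (p.1 + 1 : ℕ)) v)) := by
      intro p
      have h3 := del_gop par X (m - p.1) v
      rw [eq_sub_iff_add_eq] at h3
      rw [← h3, map_add, map_smul, divDel_del, smul_add, smul_smul (p.1 + 1 : ℂ),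
        ← succ_mul_choose, show m - (p.1 : ℤ) - 1 = m - (p.1 + 1 : ℕ) by push_cast; ring]
      push_cast
      module
    rw [Finset.sum_congr rfl (fun p _ => h2 p), Finset.sum_add_distrib, Finset.smul_sum]
    have h3 : ∀ p ∈ Finset.HasAntidiagonal.antidiagonal (k + 1), ((k : ℂ) + 1) • (((Ring.choose m p.1 : ℤ) : ℂ) •
        divDel par p.2 (gop par X (m - p.1) v)) =
        (p.2 : ℂ) • (((Ring.choose m p.1 : ℤ) : ℂ) • divDel par p.2 (gop par X (m - p.1) v))
        + (p.1 : ℂ) • (((Ring.choose m p.1 : ℤ) : ℂ) •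
          divDel par p.2 (gop par X (m - p.1) v)) := by
      intro p hp
      have : (p.1 : ℂ) + p.2 = k + 1 := by exact_mod_cast Finset.HasAntidiagonal.mem_antidiagonal.1 hp
      rw [← this]
      module
    rw [Finset.sum_congr rfl h3, Finset.sum_add_distrib]
    congr 1
    · rw [Finset.Nat.sum_antidiagonal_succ']
      simp
    · rw [Finset.Nat.sum_antidiagonal_succ]
      simp

/-- The vectors `v_(n) |0⟩`: the coefficients of `e^(z∂) v = ∑ₙ z^(-n-1) v_(n) |0⟩`. -/
noncomputable def creation : Fch par →ₗ[ℂ] (ℤ → Fch par) :=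
  LinearMap.pi fun n => if n < 0 then divDel par (-n - 1).toNat else 0

theorem fieldOp_creation (X : Comp A) (m : ℤ) (hm : 0 ≤ m) :
    fieldOp par X m (creation par) = 0 := by
  obtain ⟨m, rfl⟩ := Int.eq_ofNat_of_zero_le hm
  ext v n
  obtain ⟨N, hN⟩ := gop_trunc par (twist par (X.parity par) v)
  rw [fieldOp_apply par X m _ v n (m + 1 + N) (fun j hj => hN X j (by omega))]
  generalize twist par (X.parity par) v = u
  rw [LinearMap.zero_apply, Pi.zero_apply, sub_eq_zero, Finset.sum_range_add]
  have hz : ∀ j : ℕ, m < j → ((Ring.choose (m : ℤ) j : ℤ) : ℂ) = 0 := by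
    intro j hj
    rw [Ring.choose_natCast, Nat.choose_eq_zero_of_lt hj]
    simp
  rw [Finset.sum_eq_zero (s := Finset.range N) (fun j _ => by
    rw [hz _ (by omega), zero_smul]), add_zero, ← Finset.sum_range_reflect]
  by_cases hn : n < 0
  · obtain ⟨k, rfl⟩ : ∃ k : ℕ, n = -k - 1 := ⟨(-n - 1).toNat, by omega⟩
    have hc : ∀ w, creation par w (-k - 1 : ℤ) = divDel par k w := by
      intro w
      have e : (-(-(k : ℤ) - 1) - 1).toNat = k := by omega
      simp only [creation, LinearMap.pi_apply, if_pos hn, e]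
    rw [hc, gop_divDel, Finset.Nat.sum_antidiagonal_eq_sum_range_succ_mk]
    rw [← Finset.sum_filter_of_ne (p := fun i => i ≤ m) (s := Finset.range k.succ) (by
      intro i hi h
      by_contra h'
      exact h (by rw [hz i (Nat.lt_of_not_le h'), zero_smul]))]
    symm
    rw [← Finset.sum_filter_of_ne (p := fun i => i ≤ k) (s := Finset.range (m + 1)) (by
      intro i hi h
      by_contra h'
      replace h' : ¬ i ≤ k := h'
      rw [Finset.mem_range] at hi
      refine h ?_
      have : ¬ ((m : ℤ) + (-k - 1) - ((m + 1 - 1 - i : ℕ) : ℤ) < 0) := by omega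
      simp only [creation, LinearMap.pi_apply, if_neg this, LinearMap.zero_apply, smul_zero])]
    have hset : Finset.filter (fun i => i ≤ k) (Finset.range (m + 1))
        = Finset.filter (fun i => i ≤ m) (Finset.range k.succ) := by
      ext i; simp only [Finset.mem_filter, Finset.mem_range]; omega
    rw [hset]
    refine Finset.sum_congr rfl fun i hi => ?_
    simp only [Finset.mem_filter, Finset.mem_range] at hi
    have e1 : (m : ℤ) + (-k - 1) - ((m + 1 - 1 - i : ℕ) : ℤ) < 0 := by omega
    have e2 : (-((m : ℤ) + (-k - 1) - ((m + 1 - 1 - i : ℕ) : ℤ)) - 1).toNat = k - i := by omega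
    have e3 : ((m + 1 - 1 - i : ℕ) : ℤ) = m - i := by omega
    simp only [creation, LinearMap.pi_apply, if_pos e1, e2]
    rw [e3, Ring.choose_natCast, Ring.choose_natCast, show m + 1 - 1 - i = m - i by omega,
      Nat.choose_symm (by omega)]
  · have : creation par u n = 0 := by simp only [creation, LinearMap.pi_apply, if_neg hn]; rfl
    rw [this, map_zero, eq_comm]
    refine Finset.sum_eq_zero fun j hj => ?_
    have : ¬ ((m : ℤ) + n - ((m + 1 - 1 - j : ℕ) : ℤ) < 0) := by omega
    simp only [creation, LinearMap.pi_apply, if_neg this, LinearMap.zero_apply, smul_zero]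

/-- The map `w ↦ (v ↦ n ↦ v_(n) w)`. -/
noncomputable def fieldMap : Fch par →ₗ[ℂ] (Fch par →ₗ[ℂ] (ℤ → Fch par)) :=
  lift par
    { op := fieldOp par
      comm := fun X Y m n F => fieldOp_comm par X Y m n F
      base := creation par
      ann := fieldOp_creation par }

/-- The Fourier modes `v_(n|i)`, `i ∈ {0, 1}`, of the superfield
`Y(v, z, θ) = ∑ₙ z^(-n-1) v_(n|1) + θ ∑ₙ z^(-n-1) v_(n|0)` of a vector `v`; the second component is
the field of `D v`, that is `v_(n|0) = (D v)_(n|1)`. -/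
noncomputable def mode (v : Fch par) (n : ℤ) (i : Fin 2) : Module.End ℂ (Fch par) :=
  (LinearMap.proj n).comp ((LinearMap.applyₗ (if i = 1 then v else D par v)).comp (fieldMap par))

/-- The normally ordered product `ab = a_(-1|1) b`. -/
noncomputable def nop (a b : Fch par) : Fch par := mode par a (-1) 1 b

/-- The vector `x = x_(-1|1)|0⟩` of `F^ch_{N=1}` corresponding to a generator `x`. -/
noncomputable def genVec (x : Gen A) : Fch par := gop par (x, 1) (-1) (vac par)

/-- The vector `φ_a`. -/
noncomputable def phi (a : A) : Fch par := genVec par (.phi a)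

/-- The vector `φ^ā`. -/
noncomputable def phiBar (a : A) : Fch par := genVec par (.phiBar a)

/-! ### The shifted `N = 2` superconformal structure -/

variable [Fintype A] (t : A → ℂ)

/-- The shifted superconformal vector `T^ch_sh`. -/
noncomputable def Tsh : Fch par :=
  ∑ a with par a = 0,
    ((t a + 1) • nop par (del par (phi par a)) (phiBar par a)
      + t a • nop par (phi par a) (del par (phiBar par a))
      + nop par (D par (phi par a)) (D par (phiBar par a)))
  + ∑ a with par a = 1,
    (t a • nop par (del par (phi par a)) (phiBar par a)
      + (t a + 1) • nop par (phi par a) (del par (phiBar par a))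
      + nop par (D par (phi par a)) (D par (phiBar par a)))

/-- The standard current `J^ch_st`. -/
noncomputable def Jst : Fch par :=
  ∑ a with par a = 0, nop par (D par (phi par a)) (phiBar par a)
  + ∑ a with par a = 1, nop par (D par (phiBar par a)) (phi par a)

/-- The ghost term `J^ch_ghost`. -/
noncomputable def Jghost : Fch par :=
  ∑ a with par a = 0, t a • (nop par (D par (phi par a)) (phiBar par a)
    + nop par (phi par a) (D par (phiBar par a)))
  + ∑ a with par a = 1, t a • (nop par (D par (phiBar par a)) (phi par a)
    + nop par (phiBar par a) (D par (phi par a)))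

/-- The shifted current `J^ch_sh = J^ch_st + J^ch_ghost`. -/
noncomputable def Jsh : Fch par := Jst par + Jghost par t

/-- The vector `v` has charge `m`: it lies in the eigenspace of `J^ch_sh_(0|1)` for the
eigenvalue `m`. -/
def HasCharge (m : ℂ) (v : Fch par) : Prop :=
  v ∈ Module.End.eigenspace (mode par (Jsh par t) 0 1) m

/-- The BRST operator `Q = (T^ch_sh_(0|1) - J^ch_sh_(0|0)) / 2`. -/
noncomputable def Q : Module.End ℂ (Fch par) :=
  (1 / 2 : ℂ) • (mode par (Tsh par t) 0 1 - mode par (Jsh par t) 0 0)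

end SUSYFermion

/-! The vector `T - DJ` collapses. Modulo reordering in the odd case, `DJ` contains the same `∂φ φ̄`
and `φ ∂φ̄` terms as `T`, and the products `Dφ Dφ̄` that it contributes have coefficients `t + 1`
and `t` with opposite signs, so `t` cancels and `T - DJ = 2 ∑ Dφ_a Dφ^ā` (`Tsh_sub_D_Jsh`). Since
`J_(0|0) = (DJ)_(0|1)`, the operator `Q` is the zero mode of the odd quadratic vector `∑ Dφ_a Dφ^ā`
(`Q_apply`).

The current is quadratic and even, so its zero mode acts diagonally on the generating modes:
`[J_(0|1), X_(m)] = c(X) X_(m)` (`current_gop`). The charges satisfy `c(Dx) = c(x) + 1` and `c(Dφ_a)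
+ c(φ^ā) = 0 = c(φ_a) + c(Dφ^ā)`. Hence `Dφ_a Dφ^ā` has charge 1, which is the conceptual reason why
its zero mode raises the charge by 1.

The formal argument is more elementary. The supercommutator with `Q` sends `x_(m)` to a multiple of
`(Dx)_(m)` and kills `(Dx)_(m)` (`Q_gop`), and both zero modes kill the vacuum. Induction over
products of modes applied to the vacuum then gives `[J_(0|1), Q] = Q` (`current_Q`), and the claim
follows on eigenvectors. -/

namespace SUSYFermion

/-! ### Fields of the vacuum, of the generators and of their derivatives -/

section Fields

variable {A : Type*} (par : A → ZMod 2)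

theorem Gen.dual_dual (x : Gen A) : x.dual.dual = x := by
  cases x <;> rfl

theorem parity_one (x : Gen A) : Comp.parity par (x, 1) = x.parity par := by
  have h : (1 : ZMod 2) + 1 = 0 := by decide
  simp only [Comp.parity]
  linear_combination h

theorem parity_zero (x : Gen A) : Comp.parity par (x, 0) = x.parity par + 1 := by
  simp only [Comp.parity, add_zero]

theorem sgn_mul_self_arg (i : ZMod 2) : sgn (i * i) = sgn i := by
  rcases zmod_two_cases i with rfl | rfl <;> simp

/-- The super-skew-symmetry of the pairing. -/
theorem pairing_symm (X Y : Comp A) :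
    pairing par Y X = - sgn (X.parity par * Y.parity par) * pairing par X Y := by
  have h2 : (1 : ZMod 2) + 1 = 0 := by decide
  obtain ⟨x, i⟩ := X
  obtain ⟨y, k⟩ := Y
  by_cases hd : y = x.dual
  · subst hd
    have hx := sgn_mul_self (x.parity par)
    rcases zmod_two_cases i with rfl | rfl <;> rcases zmod_two_cases k with rfl | rfl <;>
      simp [pairing, Gen.dual_dual, h2, parity_one, parity_zero, Gen.parity_dual,
        sgn_mul_self_arg, sgn_add, sgn_one, add_assoc, hx]
  · have hd' : x ≠ y.dual := fun h => hd (by rw [h, Gen.dual_dual])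
    simp [pairing, hd, hd']

theorem twist_vac (p : ZMod 2) : twist par p (vac par) = vac par := by
  rcases zmod_two_cases p with rfl | rfl <;> simp [twist, parityOp_vac]

theorem fieldMap_vac : fieldMap par (vac par) = creation par :=
  lift_vac par _

theorem fieldMap_gop (X : Comp A) (m : ℤ) (w : Fch par) :
    fieldMap par (gop par X m w) = fieldOp par X m (fieldMap par w) :=
  lift_gop par _ X m w

/-- The commutator formula solved for `v_(n) X_(m) w`. This is the recursion behind every
computation of a field below; `N` may be any truncation bound, so it is chosen to leave as few terms
as possible. -/
theorem fieldMap_gop_apply (X : Comp A) (m : ℤ) (w v : Fch par) (n : ℤ) (N : ℕ)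
    (hN : ∀ j : ℕ, N ≤ j → gop par X j (twist par (X.parity par) v) = 0) :
    fieldMap par (gop par X m w) v n =
      gop par X m (fieldMap par w (twist par (X.parity par) v) n)
      - ∑ j ∈ Finset.range N, ((Ring.choose m j : ℤ) : ℂ) •
          fieldMap par w (gop par X j (twist par (X.parity par) v)) (m + n - j) := by
  rw [fieldMap_gop, fieldOp_apply par X m _ v n N hN]

theorem creation_neg (v : Fch par) (k : ℕ) : creation par v (-k - 1 : ℤ) = divDel par k v := by
  have e : (-(-(k : ℤ) - 1) - 1).toNat = k := by omega
  simp only [creation, LinearMap.pi_apply, if_pos (show -(k : ℤ) - 1 < 0 by omega), e]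

theorem creation_nonneg (v : Fch par) (n : ℤ) (hn : 0 ≤ n) : creation par v n = 0 := by
  simp only [creation, LinearMap.pi_apply, if_neg (not_lt.2 hn), LinearMap.zero_apply]

/-- The field of the vacuum is the identity. -/
theorem fieldMap_apply_vac (w : Fch par) (n : ℤ) :
    fieldMap par w (vac par) n = if n = -1 then w else 0 := by
  induction w using Fch.induction with
  | hvac =>
    rw [fieldMap_vac]
    rcases lt_or_ge n 0 with hn | hn
    · obtain ⟨k, rfl⟩ : ∃ k : ℕ, n = -k - 1 := ⟨(-n - 1).toNat, by omega⟩
      rw [creation_neg]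
      rcases k with _ | k
      · simp [divDel]
      · rw [if_neg (by omega), divDel, pow_succ]
        simp [del_vac]
    · rw [creation_nonneg par _ n hn, if_neg (by omega)]
  | hadd v w hv hw => rw [map_add, LinearMap.add_apply, Pi.add_apply, hv, hw]; split_ifs <;> simp
  | hsmul c v hv => rw [map_smul, LinearMap.smul_apply, Pi.smul_apply, hv]; split_ifs <;> simp
  | hgop X m w hw =>
    -- All nonnegative modes kill the vacuum, so the bound 0 works and the correction sum is empty.
    rw [fieldMap_gop_apply par X m w _ n 0 (fun j _ => by
      rw [twist_vac, gop_vac par _ _ (by omega)]), twist_vac, hw]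
    split_ifs <;> simp

/-- Iterating `[∂, Y_(n)] = -n Y_(n-1)` from `n = -1` collects the factors `1, 2, …, k`. -/
theorem del_pow_gop_vac (Y : Comp A) (k : ℕ) :
    (del par ^ k) (gop par Y (-1) (vac par)) = (k.factorial : ℂ) • gop par Y (-k - 1) (vac par) := by
  induction k with
  | zero => simp
  | succ k ih =>
    rw [pow_succ', Module.End.mul_apply, ih, map_smul, del_gop, del_vac, map_zero, zero_sub,
      Nat.factorial_succ, show -(k : ℤ) - 1 - 1 = -((k + 1 : ℕ) : ℤ) - 1 by push_cast; ring]
    push_cast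
    module

theorem divDel_gop_vac (Y : Comp A) (k : ℕ) :
    divDel par k (gop par Y (-1) (vac par)) = gop par Y (-k - 1) (vac par) := by
  rw [divDel, LinearMap.smul_apply, del_pow_gop_vac, smul_smul, inv_mul_cancel₀, one_smul]
  exact_mod_cast Nat.factorial_ne_zero k

theorem del_gop_neg_one_vac (Y : Comp A) :
    del par (gop par Y (-1) (vac par)) = gop par Y (-2) (vac par) := by
  rw [del_gop, del_vac, map_zero, zero_sub]
  norm_num

theorem gop_gop_vac (X Y : Comp A) (j k : ℤ) (hj : 0 ≤ j) :
    gop par X j (gop par Y k (vac par)) =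
      (if j + k = -1 then pairing par X Y else 0) • vac par := by
  rw [gop_comm, gop_vac par X j hj, map_zero, smul_zero, zero_add]

/-- The field of `Y_(-1)|0⟩` has the modes `Y_(n)`. -/
theorem fieldMap_apply_gop_vac (Y : Comp A) (w : Fch par) (n : ℤ) :
    fieldMap par w (gop par Y (-1) (vac par)) n = gop par Y n w := by
  induction w using Fch.induction with
  | hvac =>
    rw [fieldMap_vac]
    rcases lt_or_ge n 0 with hn | hn
    · obtain ⟨k, rfl⟩ : ∃ k : ℕ, n = -k - 1 := ⟨(-n - 1).toNat, by omega⟩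
      rw [creation_neg, divDel_gop_vac]
    · rw [creation_nonneg par _ n hn, gop_vac par _ _ hn]
  | hadd v w hv hw => rw [map_add, LinearMap.add_apply, Pi.add_apply, hv, hw, map_add]
  | hsmul c v hv => rw [map_smul, LinearMap.smul_apply, Pi.smul_apply, hv, map_smul]
  | hgop X m w hw =>
    -- Only `j = 0` survives, since `X_(j) Y_(-1)|0⟩ = 0` for `j ≥ 1`. What remains differs from
    -- `Y_(n) X_(m) w` in the order of `X` and `Y` in the scalar term, which is repaired by the
    -- super-skew-symmetry of the pairing.
    rw [fieldMap_gop_apply par X m w _ n 1 (fun j hj => by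
        rw [twist_gop, twist_vac, map_smul, gop_gop_vac par _ _ _ _ (by omega),
          if_neg (by omega), zero_smul, smul_zero]), twist_gop, twist_vac, gop_comm par Y X n m,
      pairing_symm par X Y, mul_comm (Y.parity par)]
    simp only [map_smul, Pi.smul_apply, hw, Finset.sum_range_one, Ring.choose_zero_right,
      gop_gop_vac par X Y _ _ (le_refl ((0 : ℕ) : ℤ)), fieldMap_apply_vac, add_comm n m]
    split_ifs <;> first | omega | simp [smul_smul, sub_eq_add_neg]

/-- The field of `Y_(-2)|0⟩` is the derivative of that of `Y_(-1)|0⟩`. -/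
theorem fieldMap_apply_gop_neg_two_vac (Y : Comp A) (w : Fch par) (n : ℤ) :
    fieldMap par w (gop par Y (-2) (vac par)) n = (-(n : ℂ)) • gop par Y (n - 1) w := by
  induction w using Fch.induction with
  | hvac =>
    rw [fieldMap_vac]
    rcases lt_or_ge n 0 with hn | hn
    · obtain ⟨k, rfl⟩ : ∃ k : ℕ, n = -k - 1 := ⟨(-n - 1).toNat, by omega⟩
      rw [creation_neg, ← del_gop_neg_one_vac, divDel_del, divDel_gop_vac]
      push_cast
      rw [show -((k : ℤ) + 1) - 1 = -(k : ℤ) - 1 - 1 by ring]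
      congr 1
      ring
    · rw [creation_nonneg par _ n hn]
      rcases hn.eq_or_lt with rfl | hn
      · simp
      · rw [gop_vac par _ _ (by omega), smul_zero]
  | hadd v w hv hw => rw [map_add, LinearMap.add_apply, Pi.add_apply, hv, hw, map_add, smul_add]
  | hsmul c v hv => rw [map_smul, LinearMap.smul_apply, Pi.smul_apply, hv, map_smul, smul_comm]
  | hgop X m w hw =>
    -- For `Y_(-2)|0⟩` the only nonzero bracket is at `j = 1`, where the binomial coefficient is
    -- `m`. The scalar term lives on `m + n = 0`, where this `m` equals the factor `-n` of the
    -- differentiated field.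
    rw [fieldMap_gop_apply par X m w _ n 2 (fun j hj => by
        rw [twist_gop, twist_vac, map_smul, gop_gop_vac par _ _ _ _ (by omega),
          if_neg (by omega), zero_smul, smul_zero]), twist_gop, twist_vac,
      gop_comm par Y X (n - 1) m, pairing_symm par X Y, mul_comm (Y.parity par)]
    simp only [map_smul, Pi.smul_apply, hw, Finset.sum_range_succ, Finset.sum_range_zero, zero_add,
      Ring.choose_zero_right, Ring.choose_one_right, Nat.cast_zero, Nat.cast_one,
      gop_gop_vac par X Y _ _ (le_refl (0 : ℤ)), gop_gop_vac par X Y _ _ (zero_le_one (α := ℤ)),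
      fieldMap_apply_vac]
    by_cases h : m + n = 0
    · have hc : (m : ℂ) = -n := by
        have : ((m + n : ℤ) : ℂ) = 0 := by rw [h]; simp
        push_cast at this
        linear_combination this
      rw [if_neg (by norm_num : ¬ (-2 : ℤ) = -1), if_pos (by norm_num : (1 : ℤ) + -2 = -1),
        if_pos (by omega : m + n - 1 = -1), if_pos (by omega : n - 1 + m = -1), hc]
      module
    · rw [if_neg (by norm_num : ¬ (-2 : ℤ) = -1), if_pos (by norm_num : (1 : ℤ) + -2 = -1),
        if_neg (by omega : ¬ m + n - 1 = -1), if_neg (by omega : ¬ n - 1 + m = -1)]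
      simp only [smul_zero, zero_smul]
      module

/-! ### Quadratic vectors and the action of zero modes -/

theorem nop_gop_vac (X : Comp A) (b : Fch par) :
    nop par (gop par X (-1) (vac par)) b = gop par X (-1) b :=
  fieldMap_apply_gop_vac par X b (-1)

/-- Needed for the products `∂φ_a φ^ā` in `T`. The factor `-n` of the derivative is 1 at `n = -1`.
-/
theorem nop_gop_neg_two_vac (X : Comp A) (b : Fch par) :
    nop par (gop par X (-2) (vac par)) b = gop par X (-2) b := by
  refine (fieldMap_apply_gop_neg_two_vac par X b (-1)).trans ?_
  norm_num

theorem D_genVec (x : Gen A) : D par (genVec par x) = gop par (x, 0) (-1) (vac par) := by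
  rw [genVec, D_gop, D_vac, map_zero, smul_zero, zero_add, dop_one]

theorem del_genVec (x : Gen A) : del par (genVec par x) = gop par (x, 1) (-2) (vac par) :=
  del_gop_neg_one_vac par _

/-- The normally ordered product of two components. -/
noncomputable def quad (Y Z : Comp A) : Fch par := gop par Y (-1) (gop par Z (-1) (vac par))

theorem twist_quad (p : ZMod 2) (Y Z : Comp A) :
    twist par p (quad par Y Z) = sgn (p * (Y.parity par + Z.parity par)) • quad par Y Z := by
  rw [quad, twist_gop, twist_gop, twist_vac, map_smul, smul_smul, mul_add, sgn_add]

/-- The brackets of the generators are constants, so moving `X_(j)` to the vacuum leaves one single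
contraction with each factor, and both require `j = 0`. -/
theorem gop_quad (X Y Z : Comp A) (j : ℤ) (hj : 0 ≤ j) :
    gop par X j (quad par Y Z) =
      if j = 0 then (sgn (X.parity par * Y.parity par) * pairing par X Z) •
          gop par Y (-1) (vac par) + pairing par X Y • gop par Z (-1) (vac par) else 0 := by
  rw [quad, gop_comm, gop_gop_vac par X Z j _ hj]
  rcases eq_or_ne j 0 with rfl | h
  · simp [smul_smul]
  · simp only [if_neg h, if_neg (show ¬ j + -1 = -1 by omega), zero_smul, map_zero, smul_zero,
      add_zero]

/-- The zero mode of a vector `v` of parity `r` whose bracket with `X` is a multiple of `Y`. -/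
theorem fieldMap_gop_zero_mode (v : Fch par) (r : ZMod 2)
    (hr : ∀ p, twist par p v = sgn (p * r) • v) (X Y : Comp A) (e : ℂ)
    (h0 : gop par X 0 v = e • gop par Y (-1) (vac par))
    (h1 : ∀ j : ℤ, 1 ≤ j → gop par X j v = 0) (m : ℤ) (w : Fch par) :
    fieldMap par (gop par X m w) v 0 =
      sgn (X.parity par * r) • (gop par X m (fieldMap par w v 0) - e • gop par Y m w) := by
  rw [fieldMap_gop_apply par X m w v 0 1 (fun j hj => by
    rw [hr, map_smul, h1 _ (by omega), smul_zero]), hr]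
  simp [h0, fieldMap_apply_gop_vac, smul_sub]

/-- `Y(v, z)|0⟩ = e^(z∂) v` has no negative powers of `z`. This starts the final induction. -/
theorem fieldMap_vac_zero_mode (v : Fch par) : fieldMap par (vac par) v 0 = 0 := by
  rw [fieldMap_vac, creation_nonneg par v 0 le_rfl]

end Fields

/-! ### Brackets of the generators with the current and with `Dφ_a Dφ^ā` -/

section Charge

variable {A : Type*} (par : A → ZMod 2) (t : A → ℂ)

/-- The basis vector underlying a generator. -/
def Gen.base : Gen A → A
  | .phi a => a
  | .phiBar a => a

/-- The summand of `J^ch_sh` that belongs to a basis vector. -/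
noncomputable def currentTerm (a : A) : Fch par :=
  if par a = 0 then
    (t a + 1) • quad par (.phi a, 0) (.phiBar a, 1) + t a • quad par (.phi a, 1) (.phiBar a, 0)
  else
    (t a + 1) • quad par (.phiBar a, 0) (.phi a, 1) + t a • quad par (.phiBar a, 1) (.phi a, 0)

/-- The summand `Dφ_a Dφ^ā` of `T^ch_sh`. -/
noncomputable def brstTerm (a : A) : Fch par := quad par (.phi a, 0) (.phiBar a, 0)

theorem parity_eq_one_iff (a : A) : par a = 1 ↔ ¬ par a = 0 := by
  rcases zmod_two_cases (par a) with h | h <;> simp [h]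

/-- The coefficient of `Dx` in the bracket of `x` with `Dφ_a Dφ^ā`. -/
noncomputable def Gen.brstCoeff : Gen A → ℂ
  | .phi a => -sgn (par a)
  | .phiBar a => sgn (par a)

/-- The charge of a generator. -/
noncomputable def Gen.charge : Gen A → ℂ
  | .phi a => if par a = 0 then t a else -(t a + 1)
  | .phiBar a => if par a = 0 then -(t a + 1) else t a

/-- The charge of a component of a generating superfield. -/
noncomputable def Comp.charge (X : Comp A) : ℂ :=
  X.1.charge par t + if X.2 = 0 then 1 else 0

/-- The two factors of each product in the current have equal parity, so the current is even and its
zero mode passes every mode without a sign. -/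
theorem twist_currentTerm (p : ZMod 2) (a : A) :
    twist par p (currentTerm par t a) = currentTerm par t a := by
  have h2 : (1 : ZMod 2) + 1 = 0 := by decide
  rcases zmod_two_cases (par a) with h | h <;>
    simp [currentTerm, twist_quad, h, parity_one, parity_zero, Gen.parity, h2, sgn_zero]

/-- The parities of `Dφ_a` and `Dφ^ā` differ, so the product is odd. -/
theorem twist_brstTerm (p : ZMod 2) (a : A) :
    twist par p (brstTerm par a) = sgn p • brstTerm par a := by
  have h2 : (1 : ZMod 2) + 1 = 0 := by decide
  rcases zmod_two_cases (par a) with h | h <;>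
    simp [brstTerm, twist_quad, h, parity_zero, Gen.parity, h2]

-- The minus sign comes from the order of the bracket: here `X` acts on the current, while the
-- charge is read off from the current acting on `X`.
open Classical in
theorem gop_currentTerm (X : Comp A) (a : A) :
    gop par X 0 (currentTerm par t a) =
      (if X.1.base = a then -X.charge par t else 0) • gop par X (-1) (vac par) := by
  have h2 : (1 : ZMod 2) + 1 = 0 := by decide
  obtain ⟨x, i⟩ := X
  by_cases hb : x.base = a
  · subst hb
    rcases x with b | b <;> rcases zmod_two_cases i with rfl | rfl <;>
      rcases zmod_two_cases (par b) with h | h <;>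
      simp [currentTerm, gop_quad, Gen.base, Comp.charge, Gen.charge, pairing, Gen.dual, h,
        parity_one, parity_zero, Gen.parity, h2, sgn_zero, sgn_one] <;> module
  · rw [if_neg hb, zero_smul]
    rcases x with b | b <;> rcases zmod_two_cases (par a) with h | h <;>
      simp [currentTerm, gop_quad, pairing, Gen.dual, h, Ne.symm (show b ≠ a from hb)]

theorem gop_currentTerm_pos (X : Comp A) (a : A) (j : ℤ) (hj : 1 ≤ j) :
    gop par X j (currentTerm par t a) = 0 := by
  unfold currentTerm
  split_ifs <;>
    simp only [map_add, map_smul, gop_quad par X _ _ j (by omega), if_neg (show j ≠ 0 by omega),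
      smul_zero, add_zero]

-- A differentiated generator pairs only with an undifferentiated one. Hence `Dx` contracts with
-- neither factor of `Dφ_a Dφ^ā`, and `x` contracts with the `D` of its dual, leaving `Dx`.
open Classical in
theorem gop_brstTerm (X : Comp A) (a : A) :
    gop par X 0 (brstTerm par a) =
      (if X.1.base = a ∧ X.2 = 1 then X.1.brstCoeff par else 0) •
        gop par (X.1, 0) (-1) (vac par) := by
  have h2 : (1 : ZMod 2) + 1 = 0 := by decide
  obtain ⟨x, i⟩ := X
  by_cases hb : x.base = a
  · subst hb
    rcases x with b | b <;> rcases zmod_two_cases i with rfl | rfl <;>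
      rcases zmod_two_cases (par b) with h | h <;>
      simp [brstTerm, gop_quad, Gen.base, Gen.brstCoeff, pairing, Gen.dual, h,
        parity_one, parity_zero, Gen.parity, h2, sgn_zero, sgn_one]
  · rw [if_neg (fun h => hb h.1), zero_smul]
    rcases x with b | b <;>
      simp [brstTerm, gop_quad, pairing, Gen.dual, Ne.symm (show b ≠ a from hb)]

theorem mode_apply (v w : Fch par) : mode par v 0 1 w = fieldMap par w v 0 := by
  simp [mode]

/-! ### The commutator of the current with `Q` -/

variable [Fintype A]

theorem Jsh_eq_sum : Jsh par t = ∑ a, currentTerm par t a := by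
  simp only [Jsh, Jst, Jghost, phi, phiBar, D_genVec, Finset.sum_filter, ← Finset.sum_add_distrib]
  refine Finset.sum_congr rfl fun a _ => ?_
  simp only [parity_eq_one_iff, currentTerm, genVec, nop_gop_vac, quad]
  split_ifs <;> module

/-- For even `a`, `D(Dφ φ̄) = ∂φ φ̄ - Dφ Dφ̄` and `D(φ Dφ̄) = Dφ Dφ̄ + φ ∂φ̄`. With the weights `t +
1` and `t`, the derivative terms match those of `T` and a single `-Dφ Dφ̄` is left, which doubles
the one in `T`. For odd `a` the roles of `φ` and `φ̄` are exchanged. -/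
theorem Tsh_sub_D_Jsh : Tsh par t - D par (Jsh par t) = (2 : ℂ) • ∑ a, brstTerm par a := by
  rw [Jsh_eq_sum, map_sum, Finset.smul_sum, sub_eq_iff_eq_add, ← Finset.sum_add_distrib]
  simp only [Tsh, phi, phiBar, D_genVec, del_genVec, Finset.sum_filter, ← Finset.sum_add_distrib]
  refine Finset.sum_congr rfl fun a _ => ?_
  have h2 : (1 : ZMod 2) + 1 = 0 := by decide
  have hcomm : ∀ (X Y : Comp A) (m n : ℤ), m + n ≠ -1 → gop par X m (gop par Y n (vac par)) =
      sgn (X.parity par * Y.parity par) • gop par Y n (gop par X m (vac par)) := by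
    intro X Y m n h
    rw [gop_comm, if_neg h, zero_smul, add_zero]
  rcases zmod_two_cases (par a) with h | h
  · simp only [h, currentTerm, brstTerm, quad, genVec, nop_gop_vac, nop_gop_neg_two_vac, D_gop,
      D_vac, dop_one, dop_zero, map_add, map_smul, LinearMap.smul_apply, parity_one, parity_zero,
      Gen.parity, sgn_zero, sgn_one, h2, zero_add, map_zero, smul_zero, if_true]
    norm_num
    module
  · simp only [h, currentTerm, brstTerm, quad, genVec, nop_gop_vac, nop_gop_neg_two_vac, D_gop,
      D_vac, dop_one, dop_zero, map_add, map_smul, LinearMap.smul_apply, parity_one, parity_zero,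
      Gen.parity, sgn_zero, sgn_one, h2, zero_add, map_zero, smul_zero, one_ne_zero, if_false]
    -- For odd `a` the current puts `φ^ā` first, whereas `T` puts `φ_a` first. Reordering two
    -- creation modes produces no scalar, and no sign either, as one factor of each pair is even.
    rw [hcomm (.phi a, 1) (.phiBar a, 1) (-2) (-1) (by norm_num),
      hcomm (.phi a, 1) (.phiBar a, 1) (-1) (-2) (by norm_num),
      hcomm (.phi a, 0) (.phiBar a, 0) (-1) (-1) (by norm_num)]
    simp only [parity_one, parity_zero, Gen.parity, h, h2, mul_zero, zero_mul, sgn_zero, one_smul]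
    norm_num
    module

/-- `J_(0|0)` is by definition the zero mode of `DJ`, so `2Q` is the zero mode of `T - DJ`. -/
theorem Q_apply (w : Fch par) : Q par t w = fieldMap par w (∑ a, brstTerm par a) 0 := by
  have h : fieldMap par w (Tsh par t - D par (Jsh par t)) 0 =
      (2 : ℂ) • fieldMap par w (∑ a, brstTerm par a) 0 := by
    rw [Tsh_sub_D_Jsh, map_smul, Pi.smul_apply]
  rw [map_sub, Pi.sub_apply] at h
  have e : Q par t w = (1 / 2 : ℂ) •
      (fieldMap par w (Tsh par t) 0 - fieldMap par w (D par (Jsh par t)) 0) := by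
    simp [Q, mode]
  rw [e, h, smul_smul]
  norm_num

/-- The modes of the component `X` raise the charge by the charge of `X`. -/
theorem current_gop (X : Comp A) (m : ℤ) (w : Fch par) :
    mode par (Jsh par t) 0 1 (gop par X m w) =
      gop par X m (mode par (Jsh par t) 0 1 w) + X.charge par t • gop par X m w := by
  classical
  simp only [mode_apply]
  rw [fieldMap_gop_zero_mode par (Jsh par t) 0 (fun p => by
      simp [Jsh_eq_sum, twist_currentTerm, sgn_zero]) X X (-X.charge par t) (by
      simp only [Jsh_eq_sum, map_sum, gop_currentTerm, ← Finset.sum_smul, Finset.sum_ite_eq,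
        Finset.mem_univ, if_true]) (fun j hj => by
      simp only [Jsh_eq_sum, map_sum, gop_currentTerm_pos par t X _ j hj, Finset.sum_const_zero])]
  rw [mul_zero, sgn_zero]
  module

theorem current_vac : mode par (Jsh par t) 0 1 (vac par) = 0 := by
  rw [mode_apply, fieldMap_vac_zero_mode]

theorem Q_vac : Q par t (vac par) = 0 := by
  rw [Q_apply, fieldMap_vac_zero_mode]

/-- `Q` maps the component `x` to a multiple of `D x`, and kills `D x`. -/
theorem Q_gop (x : Gen A) (i : ZMod 2) : ∃ e : ℂ, (i = 0 → e = 0) ∧ ∀ (m : ℤ) (w : Fch par),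
    Q par t (gop par (x, i) m w) =
      sgn (Comp.parity par (x, i)) • gop par (x, i) m (Q par t w) + e • gop par (x, 0) m w := by
  classical
  -- `e` is the coefficient of the bracket of the component with `∑ Dφ_a Dφ^ā`. The witness has the
  -- opposite sign because the bracket is reversed, and a further parity sign because `Q` is odd.
  set e : ℂ := if i = 1 then x.brstCoeff par else 0 with he
  refine ⟨-(sgn (Comp.parity par (x, i)) * e), fun h => by simp [he, h], fun m w => ?_⟩
  simp only [Q_apply]
  rw [fieldMap_gop_zero_mode par _ 1 (fun p => by
      simp only [map_sum, twist_brstTerm, mul_one, Finset.smul_sum]) (x, i) (x, 0) e (by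
      simp only [map_sum, gop_brstTerm, ← Finset.sum_smul, ite_and, Finset.sum_ite_eq,
        Finset.mem_univ, if_true, he]) (fun j hj => by
      simp only [map_sum, brstTerm, gop_quad par _ _ _ j (show 0 ≤ j by omega),
        if_neg (show j ≠ 0 by omega), Finset.sum_const_zero]), mul_one]
  module

/-- The commutation relation `[J_(0|1), Q] = Q`. -/
theorem current_Q (v : Fch par) :
    mode par (Jsh par t) 0 1 (Q par t v) =
      Q par t (mode par (Jsh par t) 0 1 v) + Q par t v := by
  induction v using Fch.induction with
  | hvac => simp only [Q_vac, current_vac, map_zero, add_zero]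
  | hadd v w hv hw => simp only [map_add, hv, hw]; abel
  | hsmul c v hv => simp only [map_smul, hv, smul_add]
  | hgop X m v hv =>
    obtain ⟨x, i⟩ := X
    obtain ⟨e, he, hQ⟩ := Q_gop par t x i
    -- Either the mode is already one of `Dx` and `e = 0`, or `Q` replaces `x` by `Dx`, whose charge
    -- is larger by 1. This is the only place where the shift by 1 arises.
    have hc : e * Comp.charge par t (x, 0) = e * (Comp.charge par t (x, i) + 1) := by
      rcases zmod_two_cases i with h | h
      · rw [he h, zero_mul, zero_mul]
      · simp [Comp.charge, h]
    simp only [hQ, map_add, map_smul, current_gop, hv, smul_add, smul_smul, hc]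
    module

end Charge

end SUSYFermion

theorem propositionB4 {A : Type*} [Fintype A] (par : A → ZMod 2) (t : A → ℂ) (m : ℂ)
    (v : SUSYFermion.Fch par) (hv : SUSYFermion.HasCharge par t m v) :
    SUSYFermion.HasCharge par t (m + 1) (SUSYFermion.Q par t v) := by
  rw [SUSYFermion.HasCharge, Module.End.mem_eigenspace_iff] at hv ⊢
  rw [SUSYFermion.current_Q, hv, map_smul, add_smul, one_smul]
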